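/- Let $X$ be a Tychonoff (completely regular Hausdorff) space, and let $C_k(X)$ be the real vector space of all continuous functions $X\to\mathbb R$ with the compact-open topology. Suppose that $C_k(X)$ is bornological, i.e. every absolutely convex subset of $C_k(X)$ that absorbs all bounded sets is a neighbourhood of $0$. Then $C_k(X)$ is barrelled if and only if its underlying additive topological group is a Mackey group. Here $\widehat{(G,\tau)}$ denotes the group of continuous characters of an abelian topological group $(G,\tau)$, that is, of continuous homomorphisms from $G$ to the unit circle $\mathbb S$, and $\mathbb S_+=\{z\in\mathbb S:\operatorname{Re} z\ge 0\}$. A set $A\subseteq G$ is quasi-convex if for every $g\in G\setminus A$ there is $\chi\in\widehat{(G,\tau)}$ with $\chi(g)\notin\mathbb S_+$ and $\chi(A)\subseteq\mathbb S_+$. The group $(G,\tau)$ is locally quasi-convex if $0$ has a neighbourhood base of quasi-convex sets. A Mackey group is a locally quasi-convex abelian group $(G,\tau)$ such that every locally quasi-convex group topology $\nu$ on $G$ with $\widehat{(G,\nu)}=\widehat{(G,\tau)}$ satisfies $\nu\subseteq\tau$. -/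

import Mathlib

open Topology

/-- The continuous characters of the additive group `G` for the topology `τ`: the additive
characters `G → 𝕊` into the unit circle that are continuous for `τ`. -/
def continuousCharacters {G : Type*} [AddCommGroup G] (τ : TopologicalSpace G) :
    Set (AddChar G Circle) :=
  {χ | Continuous[τ, inferInstance] (fun g : G => χ g)}

/-- The closed right half `𝕊₊ = {z ∈ 𝕊 : 0 ≤ Re z}` of the unit circle. -/
def rightHalfCircle : Set Circle := {z | 0 ≤ (z : ℂ).re}

/-- `A` is quasi-convex in `(G, τ)`: every point outside `A` is separated from `A` by a continuous
character which maps `A` into the right half circle and the point outside of it. -/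
def IsQuasiConvex {G : Type*} [AddCommGroup G] (τ : TopologicalSpace G) (A : Set G) : Prop :=
  ∀ g ∉ A, ∃ χ ∈ continuousCharacters τ, χ g ∉ rightHalfCircle ∧ ∀ a ∈ A, χ a ∈ rightHalfCircle

/-- `(G, τ)` is a locally quasi-convex topological abelian group: `τ` is a group topology with a
base of quasi-convex neighbourhoods of `0`. -/
structure IsLocallyQuasiConvexGroup {G : Type*} [AddCommGroup G] (τ : TopologicalSpace G) :
    Prop where
  isTopologicalAddGroup : @IsTopologicalAddGroup G τ _
  exists_quasiConvex : ∀ U ∈ @nhds G τ 0, ∃ V ∈ @nhds G τ 0, V ⊆ U ∧ IsQuasiConvex τ V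

/-- Two topologies on `G` are compatible if they have the same continuous characters. -/
def CompatibleTopologies {G : Type*} [AddCommGroup G] (τ ν : TopologicalSpace G) : Prop :=
  continuousCharacters τ = continuousCharacters ν

/-- `(G, τ)` is a Mackey group (in the class of locally quasi-convex groups): it is locally
quasi-convex, and every compatible locally quasi-convex group topology `ν` is coarser than `τ`.
In Mathlib's order on topologies, `τ ≤ ν` says that every `ν`-open set is `τ`-open. -/
structure IsMackeyGroup {G : Type*} [AddCommGroup G] (τ : TopologicalSpace G) : Prop where
  locallyQuasiConvex : IsLocallyQuasiConvexGroup τ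
  finest : ∀ ν : TopologicalSpace G, IsLocallyQuasiConvexGroup ν → CompatibleTopologies τ ν → τ ≤ ν

/-- A real topological vector space `E` is a bornological space if it is locally convex and every
absolutely convex set that absorbs all (von Neumann) bounded sets is a neighbourhood of `0`. -/
structure IsBornologicalSpace (E : Type*) [AddCommGroup E] [Module ℝ E] [TopologicalSpace E] :
    Prop where
  locallyConvex : LocallyConvexSpace ℝ E
  mem_nhds_zero : ∀ U : Set E, AbsConvex ℝ U →
    (∀ B : Set E, Bornology.IsVonNBounded ℝ B → Absorbs ℝ U B) → U ∈ 𝓝 (0 : E)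

open Filter Set

/-! Both sides of the equivalence hold as soon as `C(X, ℝ)` is bornological. Barrelled implies
Mackey: let `U` be a quasi-convex neighbourhood of 0 for a compatible topology `ν`. Its characters
lift to `τ`-continuous functionals. Every pointwise cluster point of them is again `ν`-continuous,
hence `τ`-continuous, so a Glicksberg-type argument based on Riemann–Lebesgue
(`not_tendsto_cocompact_of_ultrafilterLim_mem`) makes the functionals pointwise bounded. Uniform
boundedness then makes `U` a `τ`-neighbourhood. Bornological implies barrelled (Nachbin–Shirota):
limits along an ultrafilter on a closed functionally bounded set form a bounded, hence continuous,
functional, which forces the ultrafilter to converge; so such sets are compact. The support of a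
lower semicontinuous seminorm is such a set and controls the seminorm. -/

/-! ### The right half circle -/

theorem mem_rightHalfCircle {z : Circle} : z ∈ rightHalfCircle ↔ 0 ≤ (z : ℂ).re := Iff.rfl

theorem isClosed_rightHalfCircle : IsClosed rightHalfCircle :=
  isClosed_le continuous_const (Complex.continuous_re.comp continuous_subtype_val)

theorem circleExp_mem_rightHalfCircle {t : ℝ} :
    Circle.exp t ∈ rightHalfCircle ↔ 0 ≤ Real.cos t := by
  rw [mem_rightHalfCircle, Circle.coe_exp, Complex.exp_ofReal_mul_I_re]

theorem Circle.re_sq (z : Circle) : ((z ^ 2 : Circle) : ℂ).re = 2 * (z : ℂ).re ^ 2 - 1 := by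
  have h : (z : ℂ).re * (z : ℂ).re + (z : ℂ).im * (z : ℂ).im = 1 := Circle.normSq_coe z
  rw [pow_two, Circle.coe_mul, Complex.mul_re]
  linarith

/-- The right half circle contains no nontrivial sequence of iterated squares. -/
theorem Circle.eq_one_of_forall_pow_two_pow_mem {z : Circle}
    (hz : ∀ n : ℕ, z ^ 2 ^ n ∈ rightHalfCircle) : z = 1 := by
  have hle : ∀ w : Circle, (w : ℂ).re ≤ 1 := fun w =>
    (Complex.re_le_norm _).trans_eq (Circle.norm_coe w)
  -- For `r = Re w ≥ 0`, `1 - Re w² = 2(1 - r)(1 + r) ≥ 2(1 - r)`.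
  have key : ∀ n : ℕ, 2 ^ n * (1 - (z : ℂ).re) ≤ 1 - ((z ^ 2 ^ n : Circle) : ℂ).re := by
    intro n
    induction n with
    | zero => simp
    | succ n ih =>
      have h0 : 0 ≤ ((z ^ 2 ^ n : Circle) : ℂ).re := hz n
      have h1 := hle (z ^ 2 ^ n)
      have h2 : z ^ 2 ^ (n + 1) = (z ^ 2 ^ n) ^ 2 := by rw [pow_succ, pow_mul]
      rw [h2, Circle.re_sq, pow_succ]
      nlinarith
  have hre : (z : ℂ).re = 1 := by
    refine le_antisymm (hle z) ?_
    by_contra! h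
    obtain ⟨n, hn⟩ := pow_unbounded_of_one_lt (1 / (1 - (z : ℂ).re)) one_lt_two
    have h1 : 0 < 1 - (z : ℂ).re := by linarith
    rw [div_lt_iff₀ h1] at hn
    have h0 : 0 ≤ ((z ^ 2 ^ n : Circle) : ℂ).re := hz n
    linarith [key n]
  have h : (z : ℂ).re * (z : ℂ).re + (z : ℂ).im * (z : ℂ).im = 1 := Circle.normSq_coe z
  have him : (z : ℂ).im = 0 := by
    rw [hre] at h
    have : (z : ℂ).im * (z : ℂ).im = 0 := by linarith
    exact mul_self_eq_zero.mp this
  ext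
  exact Complex.ext (by simpa using hre) (by simpa using him)

/-! ### Characters of topological groups -/

section TopologicalGroup

variable {G : Type*} [AddCommGroup G]

theorem continuous_of_continuousAt_zero_addChar [TopologicalSpace G] [IsTopologicalAddGroup G]
    (χ : AddChar G Circle) (h : Tendsto χ (𝓝 0) (𝓝 1)) : Continuous (fun g : G => χ g) := by
  rw [continuous_iff_continuousAt]
  intro x
  have h1 : Tendsto (fun y : G => χ (y - x) * χ x) (𝓝 x) (𝓝 (1 * χ x)) := by
    refine Tendsto.mul_const _ (h.comp ?_)
    have : Tendsto (fun y : G => y - x) (𝓝 x) (𝓝 (x - x)) :=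
      (continuous_sub_right x).continuousAt
    rwa [sub_self] at this
  simpa [ContinuousAt, ← AddChar.map_add_eq_mul] using h1

/-- A character that maps a neighbourhood of `0` into the right half circle is continuous. -/
theorem AddChar.continuous_of_mapsTo_rightHalfCircle [TopologicalSpace G]
    [IsTopologicalAddGroup G] {χ : AddChar G Circle} {U : Set G} (hU : U ∈ 𝓝 (0 : G))
    (h : ∀ u ∈ U, χ u ∈ rightHalfCircle) : Continuous (fun g : G => χ g) := by
  refine continuous_of_continuousAt_zero_addChar χ ?_
  rw [tendsto_iff_ultrafilter]
  intro F hF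
  -- The limit exists by compactness. Since `2 ^ n • g → 0` along `F`, every `z ^ 2 ^ n` stays in
  -- the closed half circle.
  set z := (F.map χ).lim with hz
  have hzF : Tendsto χ F (𝓝 z) := (F.map χ).le_nhds_lim
  suffices z = 1 by rwa [← this]
  refine Circle.eq_one_of_forall_pow_two_pow_mem fun n => ?_
  refine isClosed_rightHalfCircle.mem_of_tendsto (hzF.pow (2 ^ n)) ?_
  have h0 : Tendsto (fun g : G => (2 ^ n) • g) F (𝓝 0) := by
    have : Tendsto (fun g : G => (2 ^ n) • g) (𝓝 0) (𝓝 ((2 ^ n) • (0 : G))) :=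
      (continuous_nsmul (2 ^ n)).continuousAt
    rw [smul_zero] at this
    exact this.mono_left hF
  filter_upwards [h0 hU] with g hg
  rw [← AddChar.map_nsmul_eq_pow]
  exact h _ hg

/-- The pointwise limit of characters along an ultrafilter. -/
noncomputable def AddChar.ultrafilterLim {ι : Type*} (F : Ultrafilter ι)
    (χ : ι → AddChar G Circle) : AddChar G Circle where
  toFun g := (F.map fun i => χ i g).lim
  map_zero_eq_one' := by
    have h : Tendsto (fun i => χ i 0) F (𝓝 _) := (F.map fun i => χ i (0 : G)).le_nhds_lim
    simp only [AddChar.map_zero_eq_one] at h ⊢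
    exact tendsto_nhds_unique h tendsto_const_nhds
  map_add_eq_mul' a b := by
    have h : ∀ g, Tendsto (fun i => χ i g) F (𝓝 (F.map fun i => χ i g).lim) :=
      fun g => (F.map fun i => χ i g).le_nhds_lim
    refine tendsto_nhds_unique (h (a + b)) ?_
    simpa only [AddChar.map_add_eq_mul] using (h a).mul (h b)

theorem AddChar.tendsto_ultrafilterLim {ι : Type*} (F : Ultrafilter ι)
    (χ : ι → AddChar G Circle) (g : G) :
    Tendsto (fun i => χ i g) F (𝓝 (AddChar.ultrafilterLim F χ g)) :=
  (F.map fun i => χ i g).le_nhds_lim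

end TopologicalGroup

/-! ### Characters of locally convex spaces -/

section TopologicalVectorSpace

variable {E : Type*} [AddCommGroup E] [Module ℝ E]

/-- The character `x ↦ exp (i f x)` of a linear functional `f`. -/
noncomputable def AddChar.ofLinear (f : E →ₗ[ℝ] ℝ) : AddChar E Circle where
  toFun x := Circle.exp (f x)
  map_zero_eq_one' := by simp
  map_add_eq_mul' x y := by rw [map_add, Circle.exp_add]

theorem AddChar.ofLinear_apply (f : E →ₗ[ℝ] ℝ) (x : E) :
    AddChar.ofLinear f x = Circle.exp (f x) := rfl

variable [τ : TopologicalSpace E]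

theorem AddChar.ofLinear_mem_continuousCharacters (f : E →L[ℝ] ℝ) :
    AddChar.ofLinear (f : E →ₗ[ℝ] ℝ) ∈ continuousCharacters τ :=
  Circle.exp.continuous.comp f.continuous

variable [IsTopologicalAddGroup E] [ContinuousSMul ℝ E] [LocallyConvexSpace ℝ E]

/-- Continuous characters of a real locally convex space lift to continuous linear functionals. -/
theorem exists_continuousLinearMap_of_mem_continuousCharacters {χ : AddChar E Circle}
    (hχ : χ ∈ continuousCharacters τ) : ∃ f : E →L[ℝ] ℝ, ∀ x, χ x = Circle.exp (f x) := by
  obtain ⟨F, ⟨hF0, hF⟩, -⟩ := Circle.isCoveringMap_exp.existsUnique_continuousMap_lifts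
    (⟨fun x => χ x, hχ⟩ : C(E, Circle)) 0 0
    (by rw [Circle.exp_zero]; exact (AddChar.map_zero_eq_one χ).symm)
  have hF' : ∀ x, Circle.exp (F x) = χ x := fun x => congrFun hF x
  -- Both sides lift the same map on the connected space `E × E` and agree at the origin.
  have hadd : (fun q : E × E => F (q.1 + q.2)) = fun q => F q.1 + F q.2 := by
    refine Circle.isCoveringMap_exp.eq_of_comp_eq (by fun_prop) (by fun_prop) ?_ (0, 0)
      (by simp [hF0])
    funext q
    simp only [Function.comp_apply, Circle.exp_add, hF', AddChar.map_add_eq_mul]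
  let f : E →+ ℝ := ⟨⟨F, hF0⟩, fun x y => congrFun hadd (x, y)⟩
  exact ⟨f.toRealLinearMap F.continuous, fun x => (hF' x).symm⟩

/-- Real locally convex spaces are locally quasi-convex groups. -/
theorem LocallyConvexSpace.isLocallyQuasiConvexGroup : IsLocallyQuasiConvexGroup τ where
  isTopologicalAddGroup := inferInstance
  exists_quasiConvex U hU := by
    obtain ⟨C, hC, hCcl, hCU⟩ := exists_mem_nhds_isClosed_subset hU
    obtain ⟨W, ⟨hW, hWac⟩, hWC⟩ := (nhds_hasBasis_absConvex ℝ E).mem_iff.mp hC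
    have hV : closure W ∈ 𝓝 (0 : E) := mem_of_superset hW subset_closure
    have hVac : AbsConvex ℝ (closure W) := hWac.closure
    refine ⟨closure W, hV, (closure_minimal hWC hCcl).trans hCU, fun g hg => ?_⟩
    obtain ⟨f, u, hfu, hug⟩ := geometric_hahn_banach_closed_point hVac.2 isClosed_closure hg
    have hu : 0 < u := by simpa using hfu 0 (mem_of_mem_nhds hV)
    have habs : ∀ a ∈ closure W, |f a| < u := fun a ha => by
      refine abs_lt.mpr ⟨?_, hfu a ha⟩
      have := hfu (-a) (hVac.1.neg_mem_iff.mpr ha)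
      rw [map_neg] at this
      linarith
    have hfg : 0 < f g := hu.trans hug
    have hpi := Real.pi_pos
    -- Scale so that `closure W` lands in `[-π/2, π/2]` and `g` beyond it, without letting a large
    -- `f g` wrap around the circle.
    obtain ⟨c, hc0, hcu, hcg, hcg'⟩ : ∃ c : ℝ, 0 < c ∧ c * u ≤ Real.pi / 2 ∧
        Real.pi / 2 < c * f g ∧ c * f g ≤ Real.pi := by
      rcases le_total (f g) (2 * u) with h | h
      · refine ⟨Real.pi / (2 * u), by positivity, ?_, ?_, ?_⟩
        · exact le_of_eq (by field_simp)
        · rw [div_mul_eq_mul_div, div_lt_div_iff₀ two_pos (by positivity)]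
          nlinarith
        · rw [div_mul_eq_mul_div, div_le_iff₀ (by positivity)]
          nlinarith
      · refine ⟨Real.pi / f g, by positivity, ?_, ?_, ?_⟩
        · rw [div_mul_eq_mul_div, div_le_div_iff₀ hfg two_pos]
          nlinarith
        · rw [div_mul_cancel₀ _ hfg.ne']
          linarith
        · rw [div_mul_cancel₀ _ hfg.ne']
    refine ⟨_, AddChar.ofLinear_mem_continuousCharacters (c • f), ?_, fun a ha => ?_⟩
    · rw [AddChar.ofLinear_apply, circleExp_mem_rightHalfCircle, not_le]
      exact Real.cos_neg_of_pi_div_two_lt_of_lt hcg (by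
        change c * f g < _
        linarith)
    · rw [AddChar.ofLinear_apply, circleExp_mem_rightHalfCircle]
      have h1 : |c * f a| ≤ Real.pi / 2 := by
        rw [abs_mul, abs_of_pos hc0]
        exact (mul_le_mul_of_nonneg_left (habs a ha).le hc0.le).trans hcu
      exact Real.cos_nonneg_of_mem_Icc (abs_le.mp h1)

end TopologicalVectorSpace

/-- Exponentials with frequencies tending to infinity do not converge pointwise on `ℝ`. -/
theorem not_forall_tendsto_circleExp_of_tendsto_cocompact {s : ℕ → ℝ}
    (hs : Tendsto s atTop (cocompact ℝ)) (ψ : ℝ → Circle) :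
    ¬ ∀ t : ℝ, Tendsto (fun n => Circle.exp (s n * t)) atTop (𝓝 (ψ t)) := by
  intro h
  have hψ : Measurable fun t => ((ψ t : Circle) : ℂ) := by
    refine measurable_of_tendsto_metrizable (f := fun n t => ((Circle.exp (s n * t) : Circle) : ℂ))
      (fun n => ?_) ?_
    · exact (continuous_subtype_val.comp
        (Circle.exp.continuous.comp (continuous_const_mul (s n)))).measurable
    · exact tendsto_pi_nhds.mpr fun t => (continuous_subtype_val.tendsto _).comp (h t)
  -- Integrating against `conj ψ` on `[0, 1]` gives limit 0 by Riemann–Lebesgue, but `∫ |ψ|² = 1` by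
  -- dominated convergence.
  let g : ℝ → ℂ := (Icc (0 : ℝ) 1).indicator fun t => (starRingEnd ℂ) (ψ t : ℂ)
  have hlim0 : Tendsto (fun n => ∫ t, Circle.exp (s n * t) • g t) atTop (𝓝 0) := by
    have hw : Tendsto (fun n => -(s n) / (2 * Real.pi)) atTop (cocompact ℝ) := by
      have hc : Topology.IsClosedEmbedding fun x : ℝ => -x / (2 * Real.pi) := by
        exact ((Homeomorph.neg ℝ).trans
          (Homeomorph.mulRight₀ (2 * Real.pi)⁻¹ (by positivity))).isClosedEmbedding
      exact hc.tendsto_cocompact.comp hs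
    refine ((Real.tendsto_integral_exp_smul_cocompact g).comp hw).congr fun n => ?_
    refine MeasureTheory.integral_congr_ae (Eventually.of_forall fun t => ?_)
    simp only [Real.fourierChar_apply', Circle.smul_def]
    have h1 : 2 * Real.pi * -(t * (-s n / (2 * Real.pi))) = s n * t := by field_simp
    rw [h1]
  have hlim1 : Tendsto (fun n => ∫ t, Circle.exp (s n * t) • g t) atTop
      (𝓝 (∫ t, (Icc (0 : ℝ) 1).indicator (fun _ => (1 : ℂ)) t)) := by
    refine MeasureTheory.tendsto_integral_of_dominated_convergence
      ((Icc (0 : ℝ) 1).indicator fun _ => (1 : ℝ)) (fun n => ?_) ?_ (fun n => ?_) ?_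
    · refine Measurable.aestronglyMeasurable ?_
      have h1 : Measurable fun t => ((Circle.exp (s n * t) : Circle) : ℂ) :=
        (continuous_subtype_val.comp
          (Circle.exp.continuous.comp (continuous_const_mul (s n)))).measurable
      exact h1.mul ((Complex.continuous_conj.measurable.comp hψ).indicator measurableSet_Icc)
    · exact (MeasureTheory.integrable_indicator_iff measurableSet_Icc).mpr
        (MeasureTheory.integrableOn_const (by simp))
    · refine Eventually.of_forall fun t => ?_
      rw [Circle.norm_smul]
      by_cases ht : t ∈ Icc (0 : ℝ) 1 <;> simp [g, ht, Circle.norm_coe]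
    · refine Eventually.of_forall fun t => ?_
      by_cases ht : t ∈ Icc (0 : ℝ) 1
      · simp only [g, indicator_of_mem ht, Circle.smul_def, smul_eq_mul]
        have h1 := ((continuous_subtype_val.tendsto _).comp (h t)).mul_const
          ((starRingEnd ℂ) (ψ t : ℂ))
        rwa [Complex.mul_conj, Circle.normSq_coe, Complex.ofReal_one] at h1
      · simp [g, ht]
  have h2 := tendsto_nhds_unique hlim0 hlim1
  rw [MeasureTheory.integral_indicator measurableSet_Icc] at h2
  simp at h2

/-! ### Barrelled spaces are Mackey groups -/

section BarrelledMackey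

variable {E : Type*} [AddCommGroup E] [Module ℝ E] [τ : TopologicalSpace E]

/-- **Glicksberg's theorem** for a sequence: a sequence of linear functionals whose characters have
only `τ`-continuous pointwise cluster points does not tend to infinity at any point. -/
theorem not_tendsto_cocompact_of_ultrafilterLim_mem [ContinuousSMul ℝ E]
    {f : ℕ → E →ₗ[ℝ] ℝ}
    (hf : ∀ F : Ultrafilter ℕ,
      AddChar.ultrafilterLim F (fun n => AddChar.ofLinear (f n)) ∈ continuousCharacters τ) (x : E) :
    ¬ Tendsto (fun n => f n x) atTop (cocompact ℝ) := by
  intro hx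
  -- Only rational multiples of `x` are used: a countable product of circles is sequentially
  -- compact.
  obtain ⟨a, φ, hφ, ha⟩ := CompactSpace.tendsto_subseq
    (fun n => fun q : ℚ => AddChar.ofLinear (f n) ((q : ℝ) • x))
  rw [tendsto_pi_nhds] at ha
  -- the limit characters along ultrafilters, restricted to the line through `x`
  let ψ : Ultrafilter ℕ → ℝ → Circle := fun F t =>
    AddChar.ultrafilterLim (F.map φ) (fun n => AddChar.ofLinear (f n)) (t • x)
  have hψ : ∀ (F : Ultrafilter ℕ) (t : ℝ),
      Tendsto (fun n => Circle.exp (f (φ n) x * t)) F (𝓝 (ψ F t)) := by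
    intro F t
    have h : Tendsto (fun n => AddChar.ofLinear (f n) (t • x)) (Filter.map φ F) (𝓝 (ψ F t)) :=
      AddChar.tendsto_ultrafilterLim (F.map φ) _ (t • x)
    have h' : Tendsto (fun n => AddChar.ofLinear (f (φ n)) (t • x)) F (𝓝 (ψ F t)) :=
      tendsto_map'_iff.mp h
    simpa only [AddChar.ofLinear_apply, map_smul, smul_eq_mul, mul_comm t] using h'
  have hcont : ∀ F, Continuous (ψ F) := fun F =>
    (hf (F.map φ)).comp (continuous_id.smul continuous_const)
  have hrat : ∀ F : Ultrafilter ℕ, (F : Filter ℕ) ≤ atTop → ∀ q : ℚ, ψ F q = a q := by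
    intro F hF q
    refine tendsto_nhds_unique (hψ F q) ?_
    have h : Tendsto (fun n => AddChar.ofLinear (f (φ n)) ((q : ℝ) • x)) F (𝓝 (a q)) :=
      (ha q).mono_left hF
    simpa only [AddChar.ofLinear_apply, map_smul, smul_eq_mul, mul_comm (q : ℝ)] using h
  let F₀ : Ultrafilter ℕ := Ultrafilter.of atTop
  -- Continuous limits agreeing on `ℚ` coincide, so the subsequence converges on all of `ℝ`.
  have huniq : ∀ F : Ultrafilter ℕ, (F : Filter ℕ) ≤ atTop → ψ F = ψ F₀ := fun F hF =>
    Rat.denseRange_cast.equalizer (hcont F) (hcont F₀) (by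
      funext q
      exact (hrat F hF q).trans (hrat F₀ (Ultrafilter.of_le _) q).symm)
  refine not_forall_tendsto_circleExp_of_tendsto_cocompact (hx.comp hφ.tendsto_atTop) (ψ F₀)
    fun t => ?_
  rw [tendsto_iff_ultrafilter]
  intro F hF
  rw [← huniq F hF]
  exact hψ F t

/-- For a group topology `ν` compatible with `τ`, linear functionals whose characters map a given
`ν`-neighbourhood of `0` into the right half circle are pointwise bounded. -/
theorem bddAbove_abs_of_mapsTo_rightHalfCircle [ContinuousSMul ℝ E] (ν : TopologicalSpace E)
    (hν : @IsTopologicalAddGroup E ν _) (hτν : CompatibleTopologies τ ν) {U : Set E}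
    (hU : U ∈ @nhds E ν 0) {ι : Type*} {f : ι → E →ₗ[ℝ] ℝ}
    (hf : ∀ i, ∀ u ∈ U, AddChar.ofLinear (f i) u ∈ rightHalfCircle) (x : E) :
    BddAbove (range fun i => |f i x|) := by
  by_contra hb
  have hb' : ∀ n : ℕ, ∃ i, (n : ℝ) < |f i x| := by
    intro n
    obtain ⟨_, ⟨i, rfl⟩, hi⟩ := not_bddAbove_iff.mp hb n
    exact ⟨i, hi⟩
  choose k hk using hb'
  refine @not_tendsto_cocompact_of_ultrafilterLim_mem E _ _ τ _ (fun n => f (k n))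
    (fun F => ?_) x ?_
  · have h : continuousCharacters τ = continuousCharacters ν := hτν
    rw [h]
    exact @AddChar.continuous_of_mapsTo_rightHalfCircle E _ ν hν _ U hU fun u hu =>
      isClosed_rightHalfCircle.mem_of_tendsto (AddChar.tendsto_ultrafilterLim F _ u)
        (Eventually.of_forall fun n => hf (k n) u hu)
  · rw [← Metric.cobounded_eq_cocompact]
    refine tendsto_norm_atTop_iff_cobounded.mp ?_
    exact tendsto_atTop_mono (fun n => (hk n).le) tendsto_natCast_atTop_atTop

/-- The continuous linear functionals whose characters map `U` into the right half circle. -/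
def functionalPolar (U : Set E) : Set (E →ₗ[ℝ] ℝ) :=
  {f | Continuous f ∧ ∀ u ∈ U, Circle.exp (f u) ∈ rightHalfCircle}

/-- Uniform boundedness: in a barrelled space the supremum of the seminorms `|f|` is continuous, and
`|f x| < 1 < π/2` suffices. -/
theorem mem_nhds_zero_of_bddAbove_functionalPolar [BarrelledSpace ℝ E] {U : Set E}
    (hbd : ∀ x, BddAbove (range fun f : functionalPolar U => |f.1 x|)) :
    {x | ∀ f ∈ functionalPolar U, Circle.exp (f x) ∈ rightHalfCircle} ∈ 𝓝 (0 : E) := by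
  let p : functionalPolar U → Seminorm ℝ E :=
    fun f => (normSeminorm ℝ ℝ).comp f.1
  have hp : BddAbove (range p) := Seminorm.bddAbove_range_iff.mpr hbd
  have hcont := Seminorm.continuous_iSup p (fun f => f.2.1.norm) hp
  have h0 : (⨆ i, ⇑(p i)) (0 : E) < 1 := by
    rw [← Seminorm.coe_iSup_eq hp, map_zero]
    exact one_pos
  filter_upwards [hcont.continuousAt.eventually_lt continuousAt_const h0] with x hx f hf
  have hfx : |f x| < 1 := by
    refine lt_of_le_of_lt ?_ hx
    rw [iSup_apply]
    exact le_ciSup (hbd x) ⟨f, hf⟩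
  rw [circleExp_mem_rightHalfCircle]
  have := Real.pi_gt_three
  obtain ⟨h1, h2⟩ := abs_lt.mp hfx
  exact Real.cos_nonneg_of_mem_Icc ⟨by linarith, by linarith⟩

variable [IsTopologicalAddGroup E] [ContinuousSMul ℝ E] [LocallyConvexSpace ℝ E]

/-- A bipolar statement: a separating `ν`-character is `τ`-continuous by compatibility, so it lifts
to a functional. -/
theorem IsQuasiConvex.setOf_functionalPolar_subset {ν : TopologicalSpace E}
    (hτν : CompatibleTopologies τ ν) {U : Set E} (hU : IsQuasiConvex ν U) :
    {x | ∀ f ∈ @functionalPolar E _ _ τ U, Circle.exp (f x) ∈ rightHalfCircle} ⊆ U := by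
  intro x hx
  by_contra hxU
  obtain ⟨χ, hχ, hχx, hχU⟩ := hU x hxU
  have h : continuousCharacters τ = continuousCharacters ν := hτν
  rw [← h] at hχ
  obtain ⟨f, hf⟩ := @exists_continuousLinearMap_of_mem_continuousCharacters E _ _ τ _ _ _ χ hχ
  refine hχx ?_
  rw [hf]
  exact hx _ ⟨@ContinuousLinearMap.continuous _ _ _ _ _ E τ _ _ _ _ _ _ f,
    fun u hu => hf u ▸ hχU u hu⟩

theorem nhds_zero_le_of_isLocallyQuasiConvexGroup [BarrelledSpace ℝ E] {ν : TopologicalSpace E}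
    (hν : IsLocallyQuasiConvexGroup ν) (hτν : CompatibleTopologies τ ν) :
    @nhds E τ 0 ≤ @nhds E ν 0 := by
  intro U₀ hU₀
  obtain ⟨U, hU, hUU₀, hqc⟩ := hν.exists_quasiConvex U₀ hU₀
  refine mem_of_superset ?_ (Subset.trans
    (@IsQuasiConvex.setOf_functionalPolar_subset E _ _ τ _ _ _ ν hτν U hqc) hUU₀)
  refine @mem_nhds_zero_of_bddAbove_functionalPolar E _ _ τ _ U ?_
  exact @bddAbove_abs_of_mapsTo_rightHalfCircle E _ _ τ _ ν hν.isTopologicalAddGroup hτν U hU _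
    (fun f : @functionalPolar E _ _ τ U => f.1) fun f => f.2.2

theorem nhds_eq_map_add_left_nhds_zero {G : Type*} [AddGroup G] [TopologicalSpace G]
    [IsTopologicalAddGroup G] (y : G) : 𝓝 y = map (y + ·) (𝓝 0) :=
  (map_add_left_nhds_zero y).symm

theorem IsTopologicalAddGroup.le_of_nhds_zero_le {G : Type*} [AddGroup G]
    (s t : TopologicalSpace G) (hs : @IsTopologicalAddGroup G s _)
    (ht : @IsTopologicalAddGroup G t _) (h : @nhds G s 0 ≤ @nhds G t 0) : s ≤ t := by
  refine le_of_nhds_le_nhds fun y => ?_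
  rw [@nhds_eq_map_add_left_nhds_zero G _ s hs y, @nhds_eq_map_add_left_nhds_zero G _ t ht y]
  exact Filter.map_mono h

/-- Barrelled locally convex spaces are Mackey groups. -/
theorem BarrelledSpace.isMackeyGroup [BarrelledSpace ℝ E] : IsMackeyGroup τ where
  locallyQuasiConvex := LocallyConvexSpace.isLocallyQuasiConvexGroup
  finest ν hν hτν := IsTopologicalAddGroup.le_of_nhds_zero_le τ ν ‹_› hν.isTopologicalAddGroup
    (@nhds_zero_le_of_isLocallyQuasiConvexGroup E _ _ τ _ _ _ _ ν hν hτν)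

end BarrelledMackey

/-! ### The Nachbin–Shirota theorem -/

section NachbinShirota

variable {X : Type*} [TopologicalSpace X]

theorem ContinuousMap.hasBasis_nhds_real (f : C(X, ℝ)) :
    (𝓝 f).HasBasis (fun q : Set X × ℝ => IsCompact q.1 ∧ 0 < q.2)
      fun q => {g | ∀ x ∈ q.1, dist (f x) (g x) < q.2} :=
  nhds_basis_uniformity' Metric.uniformity_basis_dist.compactConvergenceUniformity

/-- In a completely regular space, a cover of a compact set by neighbourhoods admits finitely many
subordinate nonnegative functions whose sum is at least `1` on the compact set. -/
theorem IsCompact.exists_finset_bump [CompletelyRegularSpace X] {K : Set X} (hK : IsCompact K)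
    {V : X → Set X} (hV : ∀ x ∈ K, V x ∈ 𝓝 x) :
    ∃ (t : Finset X) (b : X → C(X, ℝ)), (∀ x ∈ t, x ∈ K) ∧ (∀ x y, 0 ≤ b x y) ∧
      (∀ x ∈ t, ∀ y ∉ V x, b x y = 0) ∧ ∀ y ∈ K, 1 ≤ ∑ x ∈ t, b x y := by
  have h : ∀ x, ∃ b : C(X, ℝ), (∀ y, 0 ≤ b y) ∧
      (x ∈ K → b x = 2 ∧ ∀ y ∉ V x, b y = 0) := by
    intro x
    by_cases hx : x ∈ K
    · obtain ⟨f, hf, hfx, hfV⟩ := CompletelyRegularSpace.completely_regular x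
        (interior (V x))ᶜ isOpen_interior.isClosed_compl
        (fun h => h (mem_interior_iff_mem_nhds.mpr (hV x hx)))
      refine ⟨⟨fun y => 2 * (1 - (f y : ℝ)), by fun_prop⟩, fun y => ?_, fun _ => ⟨?_, fun y hy => ?_⟩⟩
      · have := (f y).2.2
        change 0 ≤ 2 * (1 - (f y : ℝ))
        linarith
      · simp [hfx]
      · have : f y = 1 := hfV fun h => hy (interior_subset h)
        simp [this]
    · exact ⟨0, fun _ => le_rfl, fun h => absurd h hx⟩
  choose b hb0 hb using h
  obtain ⟨t, htK, ht⟩ := hK.elim_nhds_subcover (fun x => {y | 1 < b x y}) fun x hx =>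
    (isOpen_lt continuous_const (b x).continuous).mem_nhds (by
      change 1 < b x x
      rw [(hb x hx).1]
      exact one_lt_two)
  refine ⟨t, b, htK, hb0, fun x hx => (hb x (htK x hx)).2, fun y hy => ?_⟩
  obtain ⟨x, hx, hxy⟩ := mem_iUnion₂.mp (ht hy)
  exact (le_of_lt hxy).trans
    (Finset.single_le_sum (f := fun x => b x y) (fun x _ => hb0 x y) hx)

/-- A set is functionally bounded if every continuous real function is bounded on it. -/
def IsFunctionallyBounded (S : Set X) : Prop :=
  ∀ g : C(X, ℝ), ∃ M : ℝ, ∀ x ∈ S, |g x| ≤ M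

theorem IsFunctionallyBounded.exists_tendsto {S : Set X} (hS : IsFunctionallyBounded S)
    {F : Ultrafilter X} (hF : (F : Filter X) ≤ 𝓟 S) (f : C(X, ℝ)) :
    ∃ l : ℝ, Tendsto f F (𝓝 l) := by
  obtain ⟨M, hM⟩ := hS f
  obtain ⟨l, -, hl⟩ := (isCompact_Icc (a := -M) (b := M)).ultrafilter_le_nhds (F.map f) (by
    rw [le_principal_iff]
    exact Filter.mem_map.mpr (mem_of_superset (le_principal_iff.mp hF) fun x hx =>
      abs_le.mp (hM x hx)))
  exact ⟨l, hl⟩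

/-- Countably many continuous functions attain their limits along an ultrafilter on a functionally
bounded set simultaneously at some point of the space. -/
theorem IsFunctionallyBounded.exists_forall_eq_lim {S : Set X} (hS : IsFunctionallyBounded S)
    {F : Ultrafilter X} (hF : (F : Filter X) ≤ 𝓟 S) (f : ℕ → C(X, ℝ)) (l : ℕ → ℝ)
    (hl : ∀ n, Tendsto (f n) F (𝓝 (l n))) : ∃ x, ∀ n, f n x = l n := by
  -- The sum of this series vanishes exactly at the points sought and tends to 0 along `F`. Were it
  -- zero-free, its reciprocal would have a finite limit along `F`.
  let u : ℕ → X → ℝ := fun n x => (1 / 2) ^ n * min 1 |f n x - l n|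
  have hu0 : ∀ n x, 0 ≤ u n x := fun n x => by positivity
  have hule : ∀ n x, ‖u n x‖ ≤ (1 / 2 : ℝ) ^ n := fun n x => by
    rw [Real.norm_of_nonneg (hu0 n x)]
    exact mul_le_of_le_one_right (by positivity) (min_le_left _ _)
  have hsum : Summable fun n : ℕ => (1 / 2 : ℝ) ^ n := summable_geometric_two
  have hcont : Continuous fun x => ∑' n, u n x :=
    continuous_tsum (fun n => by fun_prop) hsum hule
  have hlim : Tendsto (fun x => ∑' n, u n x) F (𝓝 (∑' _ : ℕ, (0 : ℝ))) := by
    refine tendsto_tsum_of_dominated_convergence hsum (fun n => ?_)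
      (Eventually.of_forall fun x n => hule n x)
    have h1 : Tendsto (fun x => (1 / 2 : ℝ) ^ n * min 1 |f n x - l n|) F
        (𝓝 ((1 / 2 : ℝ) ^ n * min 1 |l n - l n|)) :=
      (tendsto_const_nhds.min ((hl n).sub_const (l n)).abs).const_mul _
    simpa [u] using h1
  rw [tsum_zero] at hlim
  obtain ⟨x, hx⟩ : ∃ x, ∑' n, u n x = 0 := by
    by_contra! hne
    obtain ⟨m, hm⟩ := hS.exists_tendsto hF ⟨fun x => (∑' n, u n x)⁻¹, hcont.inv₀ hne⟩
    have h1 := hlim.mul hm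
    have h2 : Tendsto (fun _ : X => (1 : ℝ)) F (𝓝 (0 * m)) :=
      h1.congr fun x => mul_inv_cancel₀ (hne x)
    have h3 := tendsto_nhds_unique h2 tendsto_const_nhds
    simp at h3
  refine ⟨x, fun n => ?_⟩
  have hs : Summable fun n => u n x := Summable.of_norm_bounded hsum fun n => hule n x
  have h0 : u n x = 0 := le_antisymm (hx ▸ hs.le_tsum n fun k _ => hu0 k x) (hu0 n x)
  have h1 : min 1 |f n x - l n| = 0 := by
    rcases mul_eq_zero.mp h0 with h | h
    · exact absurd h (by positivity)
    · exact h
  rcases min_choice 1 |f n x - l n| with h | h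
  · rw [h] at h1
    exact absurd h1 one_ne_zero
  · rw [h, abs_eq_zero] at h1
    linarith

theorem ContinuousMap.exists_abs_le_of_isVonNBounded {B : Set C(X, ℝ)}
    (hB : Bornology.IsVonNBounded ℝ B) (x : X) : ∃ M : ℝ, ∀ f ∈ B, |f x| ≤ M := by
  have h := hB.image (ContinuousMap.evalCLM ℝ x)
  rw [NormedSpace.isVonNBounded_iff, isBounded_iff_forall_norm_le] at h
  obtain ⟨M, hM⟩ := h
  exact ⟨M, fun f hf => hM _ (mem_image_of_mem _ hf)⟩

theorem IsBornologicalSpace.isCompact_of_isFunctionallyBounded [CompletelyRegularSpace X]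
    (hX : IsBornologicalSpace C(X, ℝ)) {S : Set X} (hSc : IsClosed S)
    (hS : IsFunctionallyBounded S) : IsCompact S := by
  rw [isCompact_iff_ultrafilter_le_nhds]
  intro F hF
  choose L hL using hS.exists_tendsto hF
  have hadd : ∀ f g, L (f + g) = L f + L g := fun f g =>
    tendsto_nhds_unique (hL (f + g)) ((hL f).add (hL g))
  have hsmul : ∀ (c : ℝ) f, L (c • f) = c * L f := fun c f =>
    tendsto_nhds_unique (hL (c • f)) ((hL f).const_mul c)
  let Λ : C(X, ℝ) →ₗ[ℝ] ℝ := { toFun := L, map_add' := hadd, map_smul' := hsmul }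
  have hΛ : {f | |L f| ≤ 1} = ((normSeminorm ℝ ℝ).comp Λ).closedBall 0 1 := by
    ext f
    rw [Seminorm.mem_closedBall_zero]
    rfl
  have hU : {f | |L f| ≤ 1} ∈ 𝓝 (0 : C(X, ℝ)) := by
    refine hX.mem_nhds_zero _ ?_ fun B hB => ?_
    · rw [hΛ]
      exact ⟨Seminorm.balanced_closedBall_zero _ _, Seminorm.convex_closedBall _ _ _⟩
    -- An unbounded sequence of limits would be attained at one point `x`, where `B` is bounded.
    · obtain ⟨M, hM⟩ : ∃ M : ℝ, ∀ f ∈ B, |L f| ≤ M := by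
        by_contra! h
        choose f hfB hf using fun n : ℕ => h n
        obtain ⟨x, hx⟩ := hS.exists_forall_eq_lim hF f (fun n => L (f n)) fun n => hL (f n)
        obtain ⟨M, hM⟩ := ContinuousMap.exists_abs_le_of_isVonNBounded hB x
        obtain ⟨n, hn⟩ := exists_nat_ge M
        have := hM (f n) (hfB n)
        rw [hx n] at this
        linarith [hf n]
      rw [absorbs_iff_norm]
      refine ⟨max M 1, fun c hc f hf => ?_⟩
      have hc1 : 0 < ‖c‖ := one_pos.trans_le ((le_max_right M 1).trans hc)
      have hc0 : c ≠ 0 := norm_pos_iff.mp hc1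
      rw [mem_smul_set_iff_inv_smul_mem₀ hc0]
      change |L (c⁻¹ • f)| ≤ 1
      rw [hsmul, abs_mul, abs_inv, inv_mul_le_iff₀ (by exact hc1), mul_one]
      exact (hM f hf).trans ((le_max_left M 1).trans hc)
  obtain ⟨⟨K, ε⟩, ⟨hK, hε⟩, hKU⟩ := (ContinuousMap.hasBasis_nhds_real 0).mem_iff.mp hU
  suffices ∃ x ∈ K, (F : Filter X) ≤ 𝓝 x by
    obtain ⟨x, -, hx⟩ := this
    exact ⟨x, isClosed_iff_ultrafilter.mp hSc x F hx (le_principal_iff.mp hF), hx⟩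
  by_contra! hno
  have hV : ∀ x, ∃ V : Set X, x ∈ K → V ∈ 𝓝 x ∧ V ∉ F := by
    intro x
    by_cases hx : x ∈ K
    · obtain ⟨V, hV, hVF⟩ := Filter.not_le.mp (hno x hx)
      exact ⟨V, fun _ => ⟨hV, hVF⟩⟩
    · exact ⟨univ, fun h => absurd h hx⟩
  choose V hV using hV
  obtain ⟨t, b, htK, hb0, hbV, hb1⟩ := hK.exists_finset_bump fun x hx => (hV x hx).1
  -- Vanishing on `K` forces `|L h| ≤ 1`, yet `h` equals 2 eventually along `F`.
  let h : C(X, ℝ) := ⟨fun y => 2 * max 0 (1 - ∑ x ∈ t, b x y), by fun_prop⟩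
  have hhK : ∀ y ∈ K, h y = 0 := fun y hy => by
    change 2 * max 0 (1 - ∑ x ∈ t, b x y) = 0
    rw [max_eq_left (by linarith [hb1 y hy]), mul_zero]
  have hh : |L h| ≤ 1 := hKU fun y hy => by
    rw [hhK y hy]
    simpa using hε
  have hLh : L h = 2 := by
    refine tendsto_nhds_unique (hL h) (tendsto_const_nhds.congr' ?_)
    have hev : ∀ᶠ y in (F : Filter X), ∀ x ∈ t, y ∉ V x :=
      (Finset.eventually_all t).mpr fun x hx =>
        Ultrafilter.compl_mem_iff_notMem.mpr (hV x (htK x hx)).2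
    filter_upwards [hev] with y hy
    change 2 = 2 * max 0 (1 - ∑ x ∈ t, b x y)
    rw [Finset.sum_eq_zero fun x hx => hbV x hx y (hy x hx)]
    norm_num
  rw [hLh] at hh
  norm_num at hh

namespace Seminorm

variable {p : Seminorm ℝ C(X, ℝ)}

/-- Lower semicontinuous seminorms on `C(X, ℝ)` are bounded on order intervals. -/
theorem exists_le_of_abs_le (hp : LowerSemicontinuous p) {g : C(X, ℝ)} (hg : ∀ x, 1 ≤ g x) :
    ∃ C : ℝ, ∀ f : C(X, ℝ), (∀ x, |f x| ≤ g x) → p f ≤ C := by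
  -- Multiplication by `g` maps the unit ball of a Banach space onto the order interval `[-g, g]`;
  -- there lower semicontinuity of `p.comp T` gives continuity.
  let T : BoundedContinuousFunction X ℝ →ₗ[ℝ] C(X, ℝ) :=
    (LinearMap.mulLeft ℝ g).comp
      (BoundedContinuousFunction.toContinuousMapLinearMap X ℝ ℝ)
  have hT : Continuous T := by
    rw [continuous_iff_continuousAt]
    intro a
    refine (ContinuousMap.hasBasis_nhds_real _).tendsto_right_iff.mpr fun q hq => ?_
    obtain ⟨M, hM⟩ := hq.1.exists_bound_of_continuousOn g.continuous.continuousOn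
    have hM1 : 0 < max M 1 := one_pos.trans_le (le_max_right M 1)
    filter_upwards [Metric.ball_mem_nhds a (div_pos hq.2 hM1)] with c hc x hx
    change dist (g x * a x) (g x * c x) < q.2
    rw [Metric.mem_ball', lt_div_iff₀' hM1] at hc
    rw [Real.dist_eq, ← mul_sub, abs_mul, ← Real.dist_eq]
    exact (mul_le_mul ((hM x hx).trans (le_max_left M 1))
      (BoundedContinuousFunction.dist_coe_le_dist x) dist_nonneg hM1.le).trans_lt hc
  have hq : Continuous (p.comp T) := by
    refine Seminorm.continuous_of_lowerSemicontinuous (𝕜 := ℝ) _ ?_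
    exact hp.comp hT
  obtain ⟨C, hC0, hC⟩ := Seminorm.bound_of_continuous_normedSpace _ hq
  refine ⟨C * 1, fun f hf => ?_⟩
  have hg0 : ∀ x, 0 < g x := fun x => one_pos.trans_le (hg x)
  let a : BoundedContinuousFunction X ℝ := BoundedContinuousFunction.ofNormedAddCommGroup
    (fun x => f x / g x) (f.continuous.div g.continuous fun x => (hg0 x).ne') 1 fun x => by
      rw [norm_div, Real.norm_of_nonneg (hg0 x).le, div_le_one (hg0 x)]
      exact hf x
  have hTa : T a = f := by
    ext x
    exact mul_div_cancel₀ _ (hg0 x).ne'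
  rw [← hTa]
  refine (hC a).trans (mul_le_mul_of_nonneg_left ?_ hC0.le)
  exact BoundedContinuousFunction.norm_ofNormedAddCommGroup_le _ zero_le_one _

/-- The support of a seminorm on `C(X, ℝ)`. -/
def functionSupport (p : Seminorm ℝ C(X, ℝ)) : Set X :=
  {x | ∀ V ∈ 𝓝 x, ∃ f : C(X, ℝ), (∀ y ∉ V, f y = 0) ∧ p f ≠ 0}

theorem isClosed_functionSupport : IsClosed p.functionSupport := by
  rw [← isOpen_compl_iff, isOpen_iff_mem_nhds]
  intro x hx
  simp only [functionSupport, mem_compl_iff, mem_ofPred_eq, not_forall] at hx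
  obtain ⟨V, hV, hVf⟩ := hx
  filter_upwards [interior_mem_nhds.mpr hV] with y hy h
  exact hVf (h V (mem_interior_iff_mem_nhds.mp hy))

theorem eq_zero_of_eqOn_functionSupport [CompletelyRegularSpace X] (hp : LowerSemicontinuous p)
    {f : C(X, ℝ)} (hf : ∀ x ∈ p.functionSupport, f x = 0) : p f = 0 := by
  have hcl : IsClosed {g | p g ≤ 0} := hp.isClosed_preimage 0
  suffices f ∈ {g | p g ≤ 0} from le_antisymm this (apply_nonneg p f)
  rw [← hcl.closure_eq, mem_closure_iff_nhds_basis (ContinuousMap.hasBasis_nhds_real f)]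
  rintro ⟨K, ε⟩ ⟨hK, hε⟩
  have hK' : IsCompact (K ∩ {x | ε ≤ |f x|}) :=
    hK.inter_right (isClosed_le continuous_const f.continuous.abs)
  have hV : ∀ x, ∃ V : Set X, x ∈ K ∩ {x | ε ≤ |f x|} →
      V ∈ 𝓝 x ∧ ∀ g : C(X, ℝ), (∀ y ∉ V, g y = 0) → p g = 0 := by
    intro x
    by_cases hx : x ∈ K ∩ {x | ε ≤ |f x|}
    · have hxS : x ∉ p.functionSupport := fun h => by
        have h1 := hx.2
        rw [mem_ofPred_eq, hf x h, abs_zero] at h1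
        exact absurd hε (not_lt.mpr h1)
      simp only [functionSupport, mem_ofPred_eq, not_forall] at hxS
      obtain ⟨V, hV, hVf⟩ := hxS
      push Not at hVf
      exact ⟨V, fun _ => ⟨hV, hVf⟩⟩
    · exact ⟨univ, fun h => absurd h hx⟩
  choose V hV using hV
  obtain ⟨t, b, htK, hb0, hbV, hb1⟩ := hK'.exists_finset_bump fun x hx => (hV x hx).1
  have hm : ∀ y, max 1 (∑ x ∈ t, b x y) ≠ 0 := fun y =>
    (one_pos.trans_le (le_max_left _ _)).ne'
  -- The weights `b x * m` sum to 1 on `K` where `|f| ≥ ε` and to at most 1 elsewhere, where the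
  -- error is at most `|f| < ε`.
  let m : C(X, ℝ) := ⟨fun y => (max 1 (∑ x ∈ t, b x y))⁻¹, Continuous.inv₀ (by fun_prop) hm⟩
  refine ⟨∑ x ∈ t, b x * (m * f), ?_, fun y hy => ?_⟩
  · refine (Finset.le_sum_of_subadditive p (map_zero p).le (map_add_le_add p) t _).trans (le_of_eq (Finset.sum_eq_zero fun x hx => ?_))
    refine (hV x (htK x hx)).2 _ fun y hy => ?_
    rw [ContinuousMap.mul_apply, hbV x hx y hy, zero_mul]
  · have hs0 : 0 ≤ ∑ x ∈ t, b x y := Finset.sum_nonneg fun x _ => hb0 x y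
    have hval : (∑ x ∈ t, b x * (m * f)) y =
        (∑ x ∈ t, b x y) * (max 1 (∑ x ∈ t, b x y))⁻¹ * f y := by
      rw [ContinuousMap.sum_apply, Finset.sum_mul, Finset.sum_mul]
      exact Finset.sum_congr rfl fun x _ => (mul_assoc _ _ _).symm
    rw [hval]
    by_cases hfy : ε ≤ |f y|
    · rw [max_eq_right (hb1 y ⟨hy, hfy⟩),
        mul_inv_cancel₀ (one_pos.trans_le (hb1 y ⟨hy, hfy⟩)).ne', one_mul, dist_self]
      exact hε
    · set r := (∑ x ∈ t, b x y) * (max 1 (∑ x ∈ t, b x y))⁻¹ with hr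
      have hr0 : 0 ≤ r := by positivity
      have hr1 : r ≤ 1 := by
        rw [hr, ← div_eq_mul_inv]
        exact div_le_one_of_le₀ (le_max_right _ _) (by positivity)
      rw [Real.dist_eq, show f y - r * f y = (1 - r) * f y by ring, abs_mul,
        abs_of_nonneg (by linarith)]
      exact (mul_le_of_le_one_left (abs_nonneg _) (by linarith)).trans_lt (not_le.mp hfy)

/-- Gliding hump: if `g` is unbounded on the support, bumps `f n` living on `{|g| > n}` with `p (f
n) = n` form a locally finite family, so one order interval contains them all, contradicting
`exists_le_of_abs_le`. -/
theorem isFunctionallyBounded_functionSupport (hp : LowerSemicontinuous p) :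
    IsFunctionallyBounded p.functionSupport := by
  intro g
  by_contra! hg
  choose x hxS hx using fun n : ℕ => hg n
  have hf : ∀ n : ℕ, ∃ f : C(X, ℝ), (∀ y, |g y| ≤ n → f y = 0) ∧ p f = n := by
    intro n
    obtain ⟨f, hfV, hpf⟩ := hxS n {y | n < |g y|}
      ((isOpen_lt continuous_const g.continuous.abs).mem_nhds (hx n))
    refine ⟨(n / p f) • f, fun y hy => ?_, ?_⟩
    · rw [ContinuousMap.smul_apply, hfV y (not_lt.mpr hy), smul_zero]
    · rw [map_smul_eq_mul, Real.norm_of_nonneg (by positivity), div_mul_cancel₀ _ hpf]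
  choose f hf0 hpf using hf
  have hsupp : ∀ n, Function.support (fun y => |f n y|) ⊆ {y | (n : ℝ) < |g y|} :=
    fun n y hy => by
      by_contra h
      exact hy (by simp [hf0 n y (not_lt.mp h)])
  have hlf : LocallyFinite fun n => Function.support fun y => |f n y| := by
    intro y
    obtain ⟨N, hN⟩ := exists_nat_gt |g y|
    refine ⟨{z | |g z| < N},
      (isOpen_lt g.continuous.abs continuous_const).mem_nhds hN,
      (finite_lt_nat N).subset ?_⟩
    rintro n ⟨z, hz, hzN⟩
    have h : (n : ℝ) < N := lt_trans (hsupp n hz) hzN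
    exact_mod_cast h
  let G : C(X, ℝ) := ⟨fun y => 1 + ∑ᶠ n, |f n y|,
    continuous_const.add (continuous_finsum (fun n => (f n).continuous.abs) hlf)⟩
  have hG0 : ∀ y, 0 ≤ ∑ᶠ n, |f n y| := fun y => finsum_nonneg fun n => abs_nonneg _
  obtain ⟨C, hC⟩ := exists_le_of_abs_le hp (g := G) fun y => le_add_of_nonneg_right (hG0 y)
  obtain ⟨n, hn⟩ := exists_nat_gt C
  have hle : p (f n) ≤ C := hC (f n) fun y => by
    have h1 : |f n y| ≤ ∑ᶠ n, |f n y| :=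
      single_le_finsum (f := fun n => |f n y|) n (hlf.point_finite y) fun j => abs_nonneg _
    exact h1.trans (le_add_of_nonneg_left zero_le_one)
  rw [hpf n] at hle
  linarith

end Seminorm

/-- If closed functionally bounded sets are compact, then `C(X, ℝ)` is
barrelled. -/
theorem ContinuousMap.barrelledSpace_of_isCompact [CompletelyRegularSpace X]
    (h : ∀ S : Set X, IsClosed S → IsFunctionallyBounded S → IsCompact S) :
    BarrelledSpace ℝ C(X, ℝ) where
  continuous_of_lowerSemicontinuous p hp := by
    have hS := h _ p.isClosed_functionSupport (Seminorm.isFunctionallyBounded_functionSupport hp)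
    obtain ⟨C, hC⟩ := Seminorm.exists_le_of_abs_le hp (g := 1) fun _ => le_rfl
    refine Seminorm.continuous' (r := C) ?_
    refine (ContinuousMap.hasBasis_nhds_real 0).mem_iff.mpr
      ⟨⟨p.functionSupport, 1⟩, ⟨hS, one_pos⟩, fun f hf => ?_⟩
    rw [Seminorm.mem_closedBall_zero]
    -- The truncation lies in `[-1, 1]`, and `f - c` vanishes on the support.
    let c : C(X, ℝ) := ⟨fun x => max (-1) (min 1 (f x)), by fun_prop⟩
    have hc : p c ≤ C := hC c fun x =>
      abs_le.mpr ⟨le_max_left _ _, max_le (by simp) (min_le_left _ _)⟩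
    have hr : p (f - c) = 0 := Seminorm.eq_zero_of_eqOn_functionSupport hp fun x hx => by
      have h1 : |f x| < 1 := by simpa using hf x hx
      obtain ⟨h2, h3⟩ := abs_lt.mp h1
      change f x - max (-1) (min 1 (f x)) = 0
      rw [min_eq_right h3.le, max_eq_right h2.le, sub_self]
    calc p f = p (c + (f - c)) := by rw [add_sub_cancel]
      _ ≤ p c + p (f - c) := map_add_le_add p _ _
      _ ≤ C := by rw [hr, add_zero]; exact hc

/-- **Nachbin–Shirota**: for completely regular `X`, a bornological `C(X, ℝ)` is barrelled. -/
theorem IsBornologicalSpace.barrelledSpace [CompletelyRegularSpace X]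
    (hX : IsBornologicalSpace C(X, ℝ)) : BarrelledSpace ℝ C(X, ℝ) :=
  ContinuousMap.barrelledSpace_of_isCompact fun _ => hX.isCompact_of_isFunctionallyBounded

end NachbinShirota

/-- For a Tychonoff space `X`, `C(X, ℝ)` carries the compact-open topology. -/
theorem corollary1p5 {X : Type*} [TopologicalSpace X] [T35Space X]
    (hX : IsBornologicalSpace C(X, ℝ)) :
    BarrelledSpace ℝ C(X, ℝ) ↔
      IsMackeyGroup (ContinuousMap.compactOpen : TopologicalSpace C(X, ℝ)) :=
  ⟨fun _ => BarrelledSpace.isMackeyGroup, fun _ => hX.barrelledSpace⟩
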